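/- Lemma 5.1 (Invertibility for compressible vectors). For $n\in\mathbb N$ and $\delta,\rho\in(0,1)$, let $\mathrm{Sparse}(\delta)$ be the set of $x\in\mathbb{R}^n$ with at most $\delta n$ nonzero coordinates, and let $\mathrm{Comp}(\delta,\rho)$ be the set of unit vectors $x\in\mathbb S^{n-1}$ that lie within Euclidean distance $\rho$ of $\mathrm{Sparse}(\delta)$. Let $\|\cdot\|$ denote the operator norm of a matrix with respect to the Euclidean norm $\|\cdot\|_2$, and let $\inf\emptyset=+\infty$. Let $K\ge 1$ and $B>0$. Then there exist constants $c_1,c_2,c_3>0$, depending only on $K$ and $B$, such that the following holds. Let $\xi$ be a real random variable with $\mathbb E\,\xi=0$, $\operatorname{Var}\xi=1$ and $\mathbb P(|\xi|>t)\le 2\exp(-t^2/B^2)$ for all $t>0$ (that is, $\xi$ is centered, of unit variance, and subgaussian with parameter $B$). Let $R_n$ be a random $n\times n$ matrix whose entries are independent copies of $\xi$. Let $\frac12<\gamma<1$, let $M$ be a deterministic real $n\times n$ matrix with $\|M\|\le n^{\gamma}$, and let $A_n=R_n+M$. Then, for all $0<\delta<c_1$, $$\mathbb P\Bigl(\inf_{x\in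 \mathrm{Comp}(\delta,\,\delta n^{1/2-\gamma})}\|A_nx\|_2\le c_2\,n^{1/2}\ \text{ and }\ \|R_n\|\le K n^{1/2}\Bigr)\le e^{-c_3 n}.$$ -/

import Mathlib

open MeasureTheory ProbabilityTheory
-- On real matrices, `‖M‖` is the operator norm for the Euclidean norms.
open scoped Matrix.Norms.L2Operator

/-- The real random variable `ξ` is subgaussian with parameter `B > 0`:
`ℙ(|ξ| > t) ≤ 2 exp(-t² / B²)` for all `t > 0`. -/
def IsSubgaussianWith {Ω : Type*} [MeasurableSpace Ω] (ξ : Ω → ℝ) (P : Measure Ω) (B : ℝ) :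
    Prop :=
  0 < B ∧ ∀ t : ℝ, 0 < t → P.real {ω | t < |ξ ω|} ≤ 2 * Real.exp (-t ^ 2 / B ^ 2)

/-- The vectors of `ℝⁿ` with at most `δ n` nonzero coordinates. -/
def SparseVec (n : ℕ) (δ : ℝ) : Set (EuclideanSpace ℝ (Fin n)) :=
  {x | ({i | x i ≠ 0}.ncard : ℝ) ≤ δ * n}

/-- The unit vectors of `ℝⁿ` that are within Euclidean distance `ρ` from the sparse vectors. -/
def CompVec (n : ℕ) (δ ρ : ℝ) : Set (EuclideanSpace ℝ (Fin n)) :=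
  {x | ‖x‖ = 1 ∧ ∃ z ∈ SparseVec n δ, dist x z ≤ ρ}

/-- The random `n × n` matrix `R` has as its entries independent copies of the random
variable `ξ` (which may live on another probability space). -/
def HasIndepCopyEntries {Ω Ω' : Type*} [MeasurableSpace Ω] [MeasurableSpace Ω'] {n : ℕ}
    (R : Ω → Matrix (Fin n) (Fin n) ℝ) (P : Measure Ω) (ξ : Ω' → ℝ) (P' : Measure Ω') : Prop :=
  iIndepFun (fun (p : Fin n × Fin n) (ω : Ω) => R ω p.1 p.2) P ∧
    ∀ i j, IdentDistrib (fun ω => R ω i j) ξ P P'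

/-- `inf_{x ∈ S} ‖A x‖₂`, as an extended nonnegative number (so that it is `∞` if `S` is empty). -/
noncomputable def infNormOn {n : ℕ} (A : Matrix (Fin n) (Fin n) ℝ)
    (S : Set (EuclideanSpace ℝ (Fin n))) : ENNReal :=
  ⨅ x ∈ S, ENNReal.ofReal ‖Matrix.toEuclideanCLM (𝕜 := ℝ) A x‖

/-- The fourth moment of a subgaussian random variable is bounded in terms of its parameter. -/
lemma exists_fourth_moment_bound (B : ℝ) (hB : 0 < B) :
    ∃ C : ℝ, 3 ≤ C ∧ ∀ (Ω : Type*) [MeasurableSpace Ω] (P : Measure Ω) [IsProbabilityMeasure P]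
      (ξ : Ω → ℝ), AEMeasurable ξ P → IsSubgaussianWith ξ P B →
        MemLp ξ 4 P ∧ ∫ ω, ξ ω ^ 4 ∂P ≤ C := by
  have hint : IntegrableOn (fun t : ℝ => 2 * (t ^ (3 : ℝ) * Real.exp (-(1 / B ^ 2) * t ^ 2)))
      (Set.Ioi 0) :=
    (integrableOn_rpow_mul_exp_neg_mul_sq (by positivity) (by norm_num)).const_mul 2
  set I : ℝ := ∫ t in Set.Ioi (0 : ℝ), 2 * (t ^ (3 : ℝ) * Real.exp (-(1 / B ^ 2) * t ^ 2))
  refine ⟨max 3 (4 * I), le_max_left _ _, fun Ω _ P _ ξ hξ hsub => ?_⟩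
  have hlin : ∫⁻ ω, ENNReal.ofReal (ξ ω ^ 4) ∂P ≤ ENNReal.ofReal (4 * I) := by
    have h1 : ∫⁻ ω, ENNReal.ofReal (ξ ω ^ 4) ∂P
        = ∫⁻ ω, ENNReal.ofReal (|ξ ω| ^ (4 : ℝ)) ∂P := by
      congr with ω
      rw [show (4 : ℝ) = ((4 : ℕ) : ℝ) by norm_num, Real.rpow_natCast,
        (by decide : Even 4).pow_abs]
    rw [h1, lintegral_rpow_eq_lintegral_meas_lt_mul P (.of_forall fun _ => abs_nonneg _)
      (by fun_prop) (by norm_num), ENNReal.ofReal_mul (by norm_num),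
      ofReal_integral_eq_lintegral_ofReal hint]
    · refine mul_le_mul_right ?_ _
      refine setLIntegral_mono' measurableSet_Ioi fun t ht => ?_
      have ht : 0 < t := ht
      rw [← ENNReal.ofReal_toReal (measure_ne_top P {a | t < |ξ a|}),
        ← ENNReal.ofReal_mul ENNReal.toReal_nonneg]
      apply ENNReal.ofReal_le_ofReal
      have := hsub.2 t ht
      rw [Measure.real] at this
      rw [show (4 : ℝ) - 1 = 3 by norm_num]
      calc _ ≤ 2 * Real.exp (-t ^ 2 / B ^ 2) * t ^ (3 : ℝ) := by gcongr
        _ = _ := by rw [show -(1 / B ^ 2) * t ^ 2 = -t ^ 2 / B ^ 2 by ring]; ring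
    · refine (ae_restrict_mem measurableSet_Ioi).mono fun t ht => ?_
      have ht : 0 < t := ht
      simp only [Pi.zero_apply]
      positivity
  have hmem : MemLp ξ 4 P := by
    refine ⟨hξ.aestronglyMeasurable, ?_⟩
    rw [eLpNorm_lt_top_iff_lintegral_rpow_enorm_lt_top (by norm_num) (by norm_num)]
    refine lt_of_le_of_lt (le_of_eq ?_) (hlin.trans_lt ENNReal.ofReal_lt_top)
    congr with ω
    rw [show (4 : ENNReal).toReal = ((4 : ℕ) : ℝ) by norm_num, ENNReal.rpow_natCast,
      Real.enorm_eq_ofReal_abs, ← ENNReal.ofReal_pow (abs_nonneg _),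
      (by decide : Even 4).pow_abs]
  refine ⟨hmem, ?_⟩
  rw [integral_eq_lintegral_of_nonneg_ae (.of_forall fun ω => by positivity)
    (by fun_prop)]
  refine le_trans ?_ (le_max_right _ _)
  refine ENNReal.toReal_le_of_le_ofReal ?_ hlin
  refine mul_nonneg (by norm_num) (setIntegral_nonneg measurableSet_Ioi fun t ht => ?_)
  have ht : 0 < t := ht
  positivity

lemma MeasureTheory.MemLp.integrable_pow_of_le_four {Ω : Type*} [MeasurableSpace Ω] {P : Measure Ω}
    [IsProbabilityMeasure P] {X : Ω → ℝ} (hX : MemLp X 4 P) {k : ℕ} (hk : k ≤ 4) :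
    Integrable (fun ω => X ω ^ k) P := by
  have h : MemLp X k P := hX.mono_exponent (by exact_mod_cast hk)
  have := h.integrable_norm_pow'
  exact this.congr' (hX.1.pow k) (.of_forall fun ω => by simp)

lemma ProbabilityTheory.IndepFun.integral_pow_mul_pow {Ω : Type*} [MeasurableSpace Ω]
    {P : Measure Ω} {X Y : Ω → ℝ} (h : IndepFun X Y P)
    (hX : AEMeasurable X P) (hY : AEMeasurable Y P) (a b : ℕ) :
    ∫ ω, X ω ^ a * Y ω ^ b ∂P = (∫ ω, X ω ^ a ∂P) * ∫ ω, Y ω ^ b ∂P :=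
  (h.comp (measurable_id.pow_const a) (measurable_id.pow_const b)).integral_mul_eq_mul_integral
    (hX.pow_const a).aestronglyMeasurable (hY.pow_const b).aestronglyMeasurable

lemma ProbabilityTheory.IndepFun.integrable_pow_mul_pow {Ω : Type*} [MeasurableSpace Ω]
    {P : Measure Ω} [IsProbabilityMeasure P] {X Y : Ω → ℝ} (h : IndepFun X Y P)
    (hX : MemLp X 4 P) (hY : MemLp Y 4 P) {a b : ℕ} (ha : a ≤ 4) (hb : b ≤ 4) :
    Integrable (fun ω => X ω ^ a * Y ω ^ b) P :=
  (h.comp (measurable_id.pow_const a) (measurable_id.pow_const b)).integrable_mul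
    (hX.integrable_pow_of_le_four ha) (hY.integrable_pow_of_le_four hb)

/-- The fourth moment of a sum of two independent centered variables. -/
lemma ProbabilityTheory.IndepFun.integral_add_pow_four {Ω : Type*} [MeasurableSpace Ω]
    {P : Measure Ω} [IsProbabilityMeasure P] {X Y : Ω → ℝ} (h : IndepFun X Y P)
    (hX : MemLp X 4 P) (hY : MemLp Y 4 P) (hX0 : ∫ ω, X ω ∂P = 0) (hY0 : ∫ ω, Y ω ∂P = 0) :
    ∫ ω, (X ω + Y ω) ^ 4 ∂P = ∫ ω, X ω ^ 4 ∂P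
      + 6 * ((∫ ω, X ω ^ 2 ∂P) * ∫ ω, Y ω ^ 2 ∂P) + ∫ ω, Y ω ^ 4 ∂P := by
  have e : ∀ ω, (X ω + Y ω) ^ 4 = X ω ^ 4 * Y ω ^ 0 + 4 * (X ω ^ 3 * Y ω ^ 1)
      + 6 * (X ω ^ 2 * Y ω ^ 2) + 4 * (X ω ^ 1 * Y ω ^ 3) + X ω ^ 0 * Y ω ^ 4 := fun ω => by ring
  have i := fun {a b : ℕ} (ha : a ≤ 4) (hb : b ≤ 4) => h.integrable_pow_mul_pow hX hY ha hb
  have i40 := i (a := 4) (b := 0) (by norm_num) (by norm_num)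
  have i31 := (i (a := 3) (b := 1) (by norm_num) (by norm_num)).const_mul 4
  have i22 := (i (a := 2) (b := 2) (by norm_num) (by norm_num)).const_mul 6
  have i13 := (i (a := 1) (b := 3) (by norm_num) (by norm_num)).const_mul 4
  have i04 := i (a := 0) (b := 4) (by norm_num) (by norm_num)
  have hm := h.integral_pow_mul_pow hX.1.aemeasurable hY.1.aemeasurable
  simp_rw [e]
  rw [integral_add (((i40.fun_add i31).fun_add i22).fun_add i13) i04, integral_add ((i40.fun_add i31).fun_add i22) i13,
    integral_add (i40.fun_add i31) i22, integral_add i40 i31]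
  simp only [integral_const_mul, hm]
  simp [hX0, hY0]

/-- The second moment of a sum of two independent centered variables. -/
lemma ProbabilityTheory.IndepFun.integral_add_sq {Ω : Type*} [MeasurableSpace Ω]
    {P : Measure Ω} [IsProbabilityMeasure P] {X Y : Ω → ℝ} (h : IndepFun X Y P)
    (hX : MemLp X 4 P) (hY : MemLp Y 4 P) (hX0 : ∫ ω, X ω ∂P = 0) :
    ∫ ω, (X ω + Y ω) ^ 2 ∂P = ∫ ω, X ω ^ 2 ∂P + ∫ ω, Y ω ^ 2 ∂P := by
  have e : ∀ ω, (X ω + Y ω) ^ 2 = X ω ^ 2 * Y ω ^ 0 + 2 * (X ω ^ 1 * Y ω ^ 1)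
      + X ω ^ 0 * Y ω ^ 2 := fun ω => by ring
  have i := fun {a b : ℕ} (ha : a ≤ 4) (hb : b ≤ 4) => h.integrable_pow_mul_pow hX hY ha hb
  have i20 := i (a := 2) (b := 0) (by norm_num) (by norm_num)
  have i11 := (i (a := 1) (b := 1) (by norm_num) (by norm_num)).const_mul 2
  have i02 := i (a := 0) (b := 2) (by norm_num) (by norm_num)
  have hm := h.integral_pow_mul_pow hX.1.aemeasurable hY.1.aemeasurable
  simp_rw [e]
  rw [integral_add (i20.fun_add i11) i02, integral_add i20 i11]
  simp only [integral_const_mul, hm]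
  simp [hX0]

/-- Moments of linear combinations of independent standardised variables. -/
lemma moments_linear_combination {Ω : Type*} [MeasurableSpace Ω]
    {P : Measure Ω} [IsProbabilityMeasure P] {ι : Type*} {X : ι → Ω → ℝ}
    {C : ℝ} (hC : 3 ≤ C) (hind : iIndepFun X P) (hX : ∀ i, MemLp (X i) 4 P)
    (h1 : ∀ i, ∫ ω, X i ω ∂P = 0) (h2 : ∀ i, ∫ ω, X i ω ^ 2 ∂P = 1)
    (h4 : ∀ i, ∫ ω, X i ω ^ 4 ∂P ≤ C) (z : ι → ℝ) (s : Finset ι) :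
    MemLp (fun ω => ∑ i ∈ s, X i ω * z i) 4 P ∧ ∫ ω, ∑ i ∈ s, X i ω * z i ∂P = 0 ∧
      ∫ ω, (∑ i ∈ s, X i ω * z i) ^ 2 ∂P = ∑ i ∈ s, z i ^ 2 ∧
      ∫ ω, (∑ i ∈ s, X i ω * z i) ^ 4 ∂P ≤ C * (∑ i ∈ s, z i ^ 2) ^ 2 := by
  classical
  have hXi : ∀ i, Integrable (X i) P := fun i => (hX i).integrable (by norm_num)
  induction s using Finset.induction_on with
  | empty => simp
  | insert a s ha ih =>
    obtain ⟨m, e1, e2, e4⟩ := ih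
    have hma : MemLp (fun ω => X a ω * z a) 4 P := by
      simpa [mul_comm] using (hX a).const_mul (z a)
    have hi : IndepFun (fun ω => X a ω * z a) (fun ω => ∑ i ∈ s, X i ω * z i) P := by
      have := (hind.comp (fun i x => x * z i) (fun i => by fun_prop)).indepFun_finsetSum_of_notMem₀
        (fun i => ((hX i).1.aemeasurable.mul_const _)) ha
      convert! this.symm using 1
      ext ω
      simp
    have ha1 : ∫ ω, X a ω * z a ∂P = 0 := by rw [integral_mul_const, h1, zero_mul]
    have ha2 : ∫ ω, (X a ω * z a) ^ 2 ∂P = z a ^ 2 := by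
      simp_rw [mul_pow]; rw [integral_mul_const, h2, one_mul]
    have ha4 : ∫ ω, (X a ω * z a) ^ 4 ∂P ≤ C * z a ^ 4 := by
      simp_rw [mul_pow]; rw [integral_mul_const]
      gcongr
      exact h4 a
    simp only [Finset.sum_insert ha]
    refine ⟨hma.add m, ?_, ?_, ?_⟩
    · rw [integral_add (hma.integrable (by norm_num)) (m.integrable (by norm_num)), ha1, e1,
        add_zero]
    · rw [hi.integral_add_sq hma m ha1, ha2, e2]
    · rw [hi.integral_add_pow_four hma m ha1 e1, ha2, e2]
      have : 0 ≤ z a ^ 2 * ∑ i ∈ s, z i ^ 2 := by positivity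
      nlinarith

lemma exp_neg_le_quadratic {x : ℝ} (hx : 0 ≤ x) : Real.exp (-x) ≤ 1 - x + x ^ 2 / 2 := by
  have h1 := Real.quadratic_le_exp_of_nonneg hx
  rw [Real.exp_neg, inv_le_comm₀ (Real.exp_pos _) (by nlinarith [sq_nonneg (x - 1)])]
  refine le_trans ?_ h1
  rw [inv_le_iff_one_le_mul₀ (by nlinarith [sq_nonneg (x - 1)])]
  nlinarith [sq_nonneg (x ^ 2)]

/-- A Laplace transform form of small ball estimates, uniform over shifts. -/
lemma integral_exp_neg_shift_sq_le {Ω : Type*} [MeasurableSpace Ω]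
    {P : Measure Ω} [IsProbabilityMeasure P] {S : Ω → ℝ} {C σ : ℝ} (hC : 3 ≤ C) (hσ : 0 < σ)
    (hS : MemLp S 4 P) (h1 : ∫ ω, S ω ∂P = 0) (h2 : ∫ ω, S ω ^ 2 ∂P = σ ^ 2)
    (h4 : ∫ ω, S ω ^ 4 ∂P ≤ C * (σ ^ 2) ^ 2) (v : ℝ) :
    ∫ ω, Real.exp (-(1 / (8 * C * σ ^ 2) * (S ω + v) ^ 2)) ∂P ≤ Real.exp (-(1 / (16 * C))) := by
  set m := σ ^ 2 + v ^ 2 with hm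
  have hC0 : 0 < C := by linarith
  have hmpos : 0 < m := by positivity
  have hY : MemLp (fun ω => S ω + v) 4 P := hS.add (memLp_const v)
  have hY2 : ∫ ω, (S ω + v) ^ 2 ∂P = m := by
    have e : ∀ ω, (S ω + v) ^ 2 = S ω ^ 2 + 2 * v * S ω + v ^ 2 := fun ω => by ring
    simp_rw [e]
    have i2 := hS.integrable_pow_of_le_four (k := 2) (by norm_num)
    have i1 := (hS.integrable (by norm_num)).const_mul (2 * v)
    rw [integral_add (i2.fun_add i1) (integrable_const _), integral_add i2 i1, integral_const_mul,
      h1, h2]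
    simp [hm]
  have i2 := hY.integrable_pow_of_le_four (k := 2) (by norm_num)
  have i4 := hY.integrable_pow_of_le_four (k := 4) (by norm_num)
  have hY4 : ∫ ω, (S ω + v) ^ 4 ∂P ≤ 8 * C * m ^ 2 := by
    have iS4 := hS.integrable_pow_of_le_four (k := 4) (by norm_num)
    calc ∫ ω, (S ω + v) ^ 4 ∂P ≤ ∫ ω, (8 * S ω ^ 4 + 8 * v ^ 4) ∂P := by
          refine integral_mono i4 ((iS4.const_mul 8).add (integrable_const _)) fun ω => ?_
          nlinarith [sq_nonneg (S ω + v), sq_nonneg (S ω - v), sq_nonneg (S ω ^ 2 - v ^ 2),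
            mul_nonneg (sq_nonneg (S ω - v)) (sq_nonneg (S ω + v)), sq_nonneg ((S ω - v) ^ 2)]
      _ = 8 * ∫ ω, S ω ^ 4 ∂P + 8 * v ^ 4 := by
          rw [integral_add (iS4.const_mul 8) (integrable_const _), integral_const_mul]
          simp
      _ ≤ 8 * (C * (σ ^ 2) ^ 2) + 8 * (C * v ^ 4) := by
          gcongr
          nlinarith [show 0 ≤ v ^ 4 by positivity]
      _ ≤ 8 * C * m ^ 2 := by
          have : 0 ≤ C * (σ ^ 2 * v ^ 2) := by positivity
          rw [hm]; nlinarith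
  set t := 1 / (8 * C * m)
  have ht : 0 < t := by positivity
  calc ∫ ω, Real.exp (-(1 / (8 * C * σ ^ 2) * (S ω + v) ^ 2)) ∂P
      ≤ ∫ ω, (1 - t * (S ω + v) ^ 2 + t ^ 2 / 2 * (S ω + v) ^ 4) ∂P := by
        refine integral_mono_of_nonneg (.of_forall fun ω => (Real.exp_pos _).le)
          (((integrable_const _).sub (i2.const_mul t)).add (i4.const_mul (t ^ 2 / 2)))
          (.of_forall fun ω => ?_)
        calc Real.exp (-(1 / (8 * C * σ ^ 2) * (S ω + v) ^ 2))
            ≤ Real.exp (-(t * (S ω + v) ^ 2)) := by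
              gcongr
              simp only [t, hm]
              gcongr
              nlinarith [sq_nonneg v]
          _ ≤ _ := (exp_neg_le_quadratic (by positivity)).trans_eq (by ring)
    _ = 1 - t * m + t ^ 2 / 2 * ∫ ω, (S ω + v) ^ 4 ∂P := by
        have i12 : Integrable (fun ω => 1 - t * (S ω + v) ^ 2) P :=
          (integrable_const 1).sub (i2.const_mul t)
        rw [integral_add i12 (i4.const_mul (t ^ 2 / 2)),
          integral_sub (integrable_const _) (i2.const_mul t), integral_const_mul,
          integral_const_mul, hY2]
        simp
    _ ≤ 1 - t * m + t ^ 2 / 2 * (8 * C * m ^ 2) := by gcongr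
    _ = -(1 / (16 * C)) + 1 := by
        simp only [t]; field_simp; ring
    _ ≤ _ := Real.add_one_le_exp _

lemma ProbabilityTheory.iIndepFun.curry {Ω ι κ : Type*} [MeasurableSpace Ω] {P : Measure Ω}
    [IsProbabilityMeasure P] [Finite ι] [Finite κ] {X : ι → κ → Ω → ℝ}
    (hX : ∀ i j, AEMeasurable (X i j) P)
    (h : iIndepFun (fun (p : ι × κ) ω => X p.1 p.2 ω) P) :
    iIndepFun (fun i ω j => X i j ω) P := by
  have hp : ∀ i j, IsProbabilityMeasure (P.map (X i j)) :=
    fun i j => Measure.isProbabilityMeasure_map (hX i j)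
  have hrow : ∀ i, iIndepFun (X i) P := fun i =>
    h.precomp (g := fun j => (i, j)) (fun a b hab => by simpa using hab)
  have hr : ∀ i, AEMeasurable (fun ω j => X i j ω) P := fun i =>
    aemeasurable_pi_lambda _ fun j => hX i j
  have hall : AEMeasurable (fun ω (p : ι × κ) => X p.1 p.2 ω) P :=
    aemeasurable_pi_lambda _ fun p => hX p.1 p.2
  rw [iIndepFun_iff_map_fun_eq_infinitePi_map₀' hr]
  have e : (fun ω i j => X i j ω)
      = MeasurableEquiv.curry ι κ ℝ ∘ fun ω (p : ι × κ) => X p.1 p.2 ω := rfl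
  rw [e, ← AEMeasurable.map_map_of_aemeasurable (by fun_prop) hall,
    h.map_fun_eq_infinitePi_map₀ hall, Measure.infinitePi_map_curry (fun i j => P.map (X i j))]
  congr with i
  rw [(hrow i).map_fun_eq_infinitePi_map₀' (hX i)]

/-- Small ball estimate for the image of a fixed vector under a shifted random matrix. -/
lemma small_ball_of_fixed_vector {Ω : Type*} [MeasurableSpace Ω] {P : Measure Ω}
    [IsProbabilityMeasure P] {n : ℕ} {R : Ω → Matrix (Fin n) (Fin n) ℝ} {C : ℝ} (hC : 3 ≤ C)
    (hind : iIndepFun (fun (p : Fin n × Fin n) (ω : Ω) => R ω p.1 p.2) P)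
    (hmem : ∀ i j, MemLp (fun ω => R ω i j) 4 P)
    (h1 : ∀ i j, ∫ ω, R ω i j ∂P = 0) (h2 : ∀ i j, ∫ ω, R ω i j ^ 2 ∂P = 1)
    (h4 : ∀ i j, ∫ ω, R ω i j ^ 4 ∂P ≤ C)
    (M : Matrix (Fin n) (Fin n) ℝ) {z : EuclideanSpace ℝ (Fin n)} (hz : z ≠ 0) :
    P.real {ω | ‖Matrix.toEuclideanCLM (𝕜 := ℝ) (R ω + M) z‖ ≤ ‖z‖ * √n / 2}
      ≤ Real.exp (-(n / (32 * C))) := by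
  have hC0 : 0 < C := by linarith
  set σ := ‖z‖ with hσdef
  have hσ : 0 < σ := norm_pos_iff.2 hz
  have hσ2 : ∑ j, z j ^ 2 = σ ^ 2 := by simp [hσdef, EuclideanSpace.norm_sq_eq]
  set t : ℝ := 1 / (8 * C * σ ^ 2) with ht
  have ht0 : 0 < t := by positivity
  set v : EuclideanSpace ℝ (Fin n) := Matrix.toEuclideanCLM (𝕜 := ℝ) M z
  set g : Fin n → (Fin n → ℝ) → ℝ := fun i r =>
    Real.exp (-(t * (∑ j, r j * z j + v i) ^ 2)) with hg
  have hrows : iIndepFun (fun i ω j => R ω i j) P :=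
    iIndepFun.curry (fun i j => (hmem i j).1.aemeasurable) hind
  have hrm : ∀ i, AEMeasurable (fun ω j => R ω i j) P := fun i =>
    aemeasurable_pi_lambda _ fun j => (hmem i j).1.aemeasurable
  have hgm : ∀ i, Measurable (g i) := fun i => by fun_prop
  have hprod := hrows.integral_fun_prod_comp hrm (f := g)
    (fun i => (hgm i).aestronglyMeasurable)
  have hrow : ∀ i, ∫ ω, g i (R ω i) ∂P ≤ Real.exp (-(1 / (16 * C))) := fun i => by
    have hi : iIndepFun (fun j ω => R ω i j) P :=
      hind.precomp (g := fun j => (i, j)) (fun a b hab => by simpa using hab)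
    obtain ⟨m, e1, e2, e4⟩ := moments_linear_combination hC hi (hmem i) (h1 i) (h2 i) (h4 i) z
      Finset.univ
    rw [hσ2] at e2 e4
    exact integral_exp_neg_shift_sq_le hC hσ m e1 e2 e4 (v i)
  have hbound : ∫ ω, ∏ i, g i (R ω i) ∂P ≤ Real.exp (-(n / (16 * C))) := by
    rw [hprod]
    calc _ ≤ ∏ _i : Fin n, Real.exp (-(1 / (16 * C))) :=
          Finset.prod_le_prod (fun i _ => integral_nonneg fun ω => (Real.exp_pos _).le)
            fun i _ => hrow i
      _ = _ := by
          rw [Finset.prod_const, Finset.card_univ, Fintype.card_fin, ← Real.exp_nat_mul]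
          congr 1; ring
  have hint : Integrable (fun ω => ∏ i, g i (R ω i)) P := by
    refine Integrable.of_bound (C := 1) ?_ (.of_forall fun ω => ?_)
    · exact (Finset.aemeasurable_fun_prod _ fun i _ =>
        (hgm i).comp_aemeasurable (hrm i)).aestronglyMeasurable
    · rw [Real.norm_of_nonneg (Finset.prod_nonneg fun i _ => (Real.exp_pos _).le)]
      refine Finset.prod_le_one (fun i _ => (Real.exp_pos _).le) fun i _ => ?_
      exact Real.exp_le_one_iff.2 (neg_nonpos.2 (by positivity))
  have hmarkov := mul_meas_ge_le_integral_of_nonneg (μ := P)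
    (.of_forall fun ω => Finset.prod_nonneg fun i _ => (Real.exp_pos _).le) hint
    (Real.exp (-(n / (32 * C))))
  have hsub : {ω | ‖Matrix.toEuclideanCLM (𝕜 := ℝ) (R ω + M) z‖ ≤ σ * √n / 2}
      ⊆ {ω | Real.exp (-(n / (32 * C))) ≤ ∏ i, g i (R ω i)} := by
    intro ω hω
    simp only [Set.mem_ofPred_eq] at hω ⊢
    have hsq : ∑ i, (∑ j, R ω i j * z j + v i) ^ 2 ≤ σ ^ 2 * n / 4 := by
      have := pow_le_pow_left₀ (norm_nonneg _) hω 2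
      rw [EuclideanSpace.norm_sq_eq] at this
      refine (le_of_eq ?_).trans (this.trans_eq ?_)
      · refine Finset.sum_congr rfl fun i _ => ?_
        rw [Real.norm_eq_abs, sq_abs, map_add]
        simp [v, Matrix.mulVec, dotProduct]
      · rw [div_pow, mul_pow, Real.sq_sqrt (by positivity)]; norm_num
    rw [hg, ← Real.exp_sum, Finset.sum_neg_distrib, ← Finset.mul_sum]
    gcongr
    calc _ ≤ t * (σ ^ 2 * n / 4) := by gcongr
      _ = _ := by rw [ht]; field_simp; ring
  have hmono : P.real {ω | ‖Matrix.toEuclideanCLM (𝕜 := ℝ) (R ω + M) z‖ ≤ σ * √n / 2}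
      ≤ P.real {ω | Real.exp (-(n / (32 * C))) ≤ ∏ i, g i (R ω i)} := measureReal_mono hsub
  refine hmono.trans ?_
  refine le_of_mul_le_mul_left ((hmarkov.trans hbound).trans_eq ?_)
    (Real.exp_pos (-(n / (32 * C))))
  rw [← Real.exp_add]
  congr 1
  ring

open Module Metric in
/-- The volumetric bound for the cardinality of separated sets in the unit ball. -/
lemma card_le_of_separated_of_norm_le_one {E : Type*} [NormedAddCommGroup E] [NormedSpace ℝ E]
    [FiniteDimensional ℝ E] {ε : ℝ} (hε : 0 < ε) (s : Finset E) (hs : ∀ c ∈ s, ‖c‖ ≤ 1)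
    (h : ∀ c ∈ s, ∀ d ∈ s, c ≠ d → ε ≤ ‖c - d‖) : (s.card : ℝ) ≤ (1 + 2 / ε) ^ finrank ℝ E := by
  borelize E
  let μ : Measure E := Measure.addHaar
  have hε2 : 0 < ε / 2 := by positivity
  have hρ : 0 < 1 + ε / 2 := by positivity
  have D : (s : Set E).PairwiseDisjoint fun c => ball c (ε / 2) := by
    rintro c hc d hd hcd
    apply ball_disjoint_ball
    rw [dist_eq_norm]
    linarith [h c hc d hd hcd]
  have hsub : ⋃ c ∈ s, ball c (ε / 2) ⊆ ball (0 : E) (1 + ε / 2) := by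
    refine Set.iUnion₂_subset fun x hx => ball_subset_ball' ?_
    rw [dist_zero_right]
    linarith [hs x hx]
  have I : (s.card : ENNReal) * ENNReal.ofReal ((ε / 2) ^ finrank ℝ E) * μ (ball 0 1) ≤
      ENNReal.ofReal ((1 + ε / 2) ^ finrank ℝ E) * μ (ball 0 1) :=
    calc _ = μ (⋃ c ∈ s, ball c (ε / 2)) := by
          rw [measure_biUnion_finset D fun c _ => measurableSet_ball]
          simp only [μ.addHaar_ball_of_pos _ hε2, Finset.sum_const, nsmul_eq_mul, mul_assoc]
      _ ≤ μ (ball (0 : E) (1 + ε / 2)) := measure_mono hsub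
      _ = _ := μ.addHaar_ball_of_pos _ hρ
  have J := (ENNReal.mul_le_mul_iff_left (measure_ball_pos _ _ zero_lt_one).ne'
    measure_ball_lt_top.ne).1 I
  have K := ENNReal.toReal_le_of_le_ofReal (by positivity) J
  rw [ENNReal.toReal_mul, ENNReal.toReal_natCast, ENNReal.toReal_ofReal (by positivity)] at K
  rw [← le_div_iff₀ (by positivity), ← div_pow] at K
  convert! K using 2
  field_simp
  ring

open Module in
/-- The unit ball of a finite-dimensional space has an `ε`-net of cardinality at most
`(1 + 2 / ε) ^ d`. -/
lemma exists_net_unit_ball (E : Type*) [NormedAddCommGroup E] [NormedSpace ℝ E]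
    [FiniteDimensional ℝ E] {ε : ℝ} (hε : 0 < ε) :
    ∃ T : Finset E, (T.card : ℝ) ≤ (1 + 2 / ε) ^ finrank ℝ E ∧
      ∀ x : E, ‖x‖ ≤ 1 → ∃ y ∈ T, ‖x - y‖ ≤ ε := by
  classical
  let Q : Set ℕ := {k | ∃ s : Finset E, (∀ c ∈ s, ‖c‖ ≤ 1) ∧
    (∀ c ∈ s, ∀ d ∈ s, c ≠ d → ε ≤ ‖c - d‖) ∧ s.card = k}
  have hb : BddAbove Q := by
    refine ⟨⌊(1 + 2 / ε) ^ finrank ℝ E⌋₊, ?_⟩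
    rintro _ ⟨s, h1, h2, rfl⟩
    exact Nat.le_floor (card_le_of_separated_of_norm_le_one hε s h1 h2)
  obtain ⟨T, h1, h2, h3⟩ := Nat.sSup_mem (s := Q) ⟨0, ∅, by simp⟩ hb
  refine ⟨T, card_le_of_separated_of_norm_le_one hε T h1 h2, fun x hx => ?_⟩
  by_contra! hcon
  have hxT : x ∉ T := fun hxT => by
    have := hcon x hxT
    simp only [sub_self, norm_zero] at this
    linarith
  have : T.card + 1 ∈ Q := by
    refine ⟨insert x T, ?_, ?_, Finset.card_insert_of_notMem hxT⟩
    · simpa using ⟨hx, h1⟩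
    · intro c hc d hd hcd
      rcases Finset.mem_insert.1 hc with rfl | hcT <;> rcases Finset.mem_insert.1 hd with rfl | hdT
      · exact absurd rfl hcd
      · exact (hcon d hdT).le
      · rw [norm_sub_rev]; exact (hcon c hcT).le
      · exact h2 c hcT d hdT hcd
  have := le_csSup hb this
  omega

open Module in
/-- A net of a subspace which is fine for the norms of both `z` and `L z`, with a cardinality that
does not depend on the size of `L`. -/
lemma exists_net_graph {E : Type*} [NormedAddCommGroup E] [NormedSpace ℝ E]
    (V : Submodule ℝ E) [FiniteDimensional ℝ V] (L : E →ₗ[ℝ] E) {a b ε : ℝ} (ha : 0 < a)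
    (hb : 0 < b) (hε : 0 < ε) :
    ∃ T : Finset E, (T.card : ℝ) ≤ (1 + 2 / ε) ^ finrank ℝ V ∧
      ∀ z ∈ V, ‖z‖ ≤ a → ‖L z‖ ≤ b → ∃ y ∈ T, ‖z - y‖ ≤ a * ε ∧ ‖L z - L y‖ ≤ b * ε := by
  classical
  let G : V →ₗ[ℝ] E × E := (a⁻¹ • V.subtype).prod (b⁻¹ • (L ∘ₗ V.subtype))
  obtain ⟨T, hT, hnet⟩ := exists_net_unit_ball (LinearMap.range G) hε
  choose w hw using fun y : LinearMap.range G => y.2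
  refine ⟨T.image fun y => (w y : E), ?_, fun z hz hza hzb => ?_⟩
  · calc ((T.image fun y => (w y : E)).card : ℝ) ≤ T.card := by
          exact_mod_cast Finset.card_image_le
      _ ≤ (1 + 2 / ε) ^ finrank ℝ (LinearMap.range G) := hT
      _ ≤ _ := by
          refine pow_le_pow_right₀ (by linarith [show 0 < 2 / ε by positivity]) ?_
          exact G.finrank_range_le
  · have hn : ∀ u : V, ‖G u‖ = max (a⁻¹ * ‖(u : E)‖) (b⁻¹ * ‖L u‖) := fun u => by
      simp [G, Prod.norm_def, norm_smul, abs_of_pos ha, abs_of_pos hb]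
    obtain ⟨y, hy, hzy⟩ := hnet ⟨G ⟨z, hz⟩, ⟨z, hz⟩, rfl⟩ (by
      rw [Submodule.coe_norm, hn]
      refine max_le ?_ ?_
      · rw [inv_mul_le_iff₀ ha]; simpa using hza
      · rw [inv_mul_le_iff₀ hb]; simpa using hzb)
    refine ⟨w y, Finset.mem_image_of_mem _ hy, ?_⟩
    rw [Submodule.coe_norm, Submodule.coe_sub, ← hw y, ← map_sub, hn, max_le_iff,
      inv_mul_le_iff₀ ha, inv_mul_le_iff₀ hb] at hzy
    simpa using hzy

lemma exists_net_supported {n : ℕ} (J : Finset (Fin n))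
    (L : EuclideanSpace ℝ (Fin n) →ₗ[ℝ] EuclideanSpace ℝ (Fin n)) {a b ε : ℝ} (ha : 0 < a)
    (hb : 0 < b) (hε : 0 < ε) :
    ∃ T : Finset (EuclideanSpace ℝ (Fin n)), (T.card : ℝ) ≤ (1 + 2 / ε) ^ J.card ∧
      ∀ z : EuclideanSpace ℝ (Fin n), (∀ i ∉ J, z i = 0) → ‖z‖ ≤ a → ‖L z‖ ≤ b →
        ∃ y ∈ T, ‖z - y‖ ≤ a * ε ∧ ‖L z - L y‖ ≤ b * ε := by
  classical
  let S := J.image fun i => EuclideanSpace.single i (1 : ℝ)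
  obtain ⟨T, hT, hnet⟩ := exists_net_graph
    (Submodule.span ℝ (S : Set (EuclideanSpace ℝ (Fin n)))) L ha hb hε
  refine ⟨T, hT.trans ?_, fun z hz => hnet z ?_⟩
  · exact pow_le_pow_right₀ (by linarith [show 0 < 2 / ε by positivity])
      ((finrank_span_finset_le_card S).trans Finset.card_image_le)
  · have : z = ∑ i ∈ J, z i • EuclideanSpace.single i (1 : ℝ) := by
      ext k
      by_cases hk : k ∈ J <;> simp [Finset.sum_apply, Pi.single_apply, hk, hz]
    rw [this]
    exact Submodule.sum_mem _ fun i hi => Submodule.smul_mem _ _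
      (Submodule.subset_span (Finset.mem_coe.2 (Finset.mem_image_of_mem _ hi)))

/-- Weighted count of the small subsets of a finite set. -/
lemma sum_pow_card_le_exp {n : ℕ} {N y δ : ℝ} (hN : 1 ≤ N) (hy : 0 < y) (hy1 : y ≤ 1) :
    ∑ J : Finset (Fin n) with (J.card : ℝ) ≤ δ * n, N ^ J.card
      ≤ Real.exp (n * (δ * Real.log (N / y) + y)) := by
  have hNy : 1 ≤ N / y := (one_le_div hy).2 (hy1.trans hN)
  calc _ ≤ ∑ J : Finset (Fin n) with (J.card : ℝ) ≤ δ * n, (N / y) ^ (δ * n) * y ^ J.card := by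
        refine Finset.sum_le_sum fun J hJ => ?_
        have hJ := (Finset.mem_filter.1 hJ).2
        calc N ^ J.card = (N / y) ^ ((J.card : ℕ) : ℝ) * y ^ J.card := by
              rw [Real.rpow_natCast, ← mul_pow, div_mul_cancel₀ _ hy.ne']
          _ ≤ _ := by gcongr
    _ ≤ ∑ J : Finset (Fin n), (N / y) ^ (δ * n) * y ^ J.card :=
        Finset.sum_le_sum_of_subset_of_nonneg (Finset.filter_subset _ _)
          fun _ _ _ => by positivity
    _ = (N / y) ^ (δ * n) * (y + 1) ^ n := by
        rw [← Finset.mul_sum]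
        congr 1
        simpa using Fintype.sum_pow_mul_eq_add_pow (Fin n) y 1
    _ ≤ Real.exp (Real.log (N / y) * (δ * n)) * (Real.exp y) ^ n := by
        rw [Real.rpow_def_of_pos (by positivity)]
        gcongr
        exact Real.add_one_le_exp y
    _ = _ := by rw [← Real.exp_nat_mul, ← Real.exp_add]; ring_nf

lemma norm_toEuclideanCLM_le {n : ℕ} (A : Matrix (Fin n) (Fin n) ℝ)
    (x : EuclideanSpace ℝ (Fin n)) : ‖Matrix.toEuclideanCLM (𝕜 := ℝ) A x‖ ≤ ‖A‖ * ‖x‖ :=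
  (Matrix.toEuclideanCLM (𝕜 := ℝ) A).le_opNorm x

lemma exists_norm_lt_of_infNormOn_le {n : ℕ} {A : Matrix (Fin n) (Fin n) ℝ}
    {S : Set (EuclideanSpace ℝ (Fin n))} {r s : ℝ} (h : infNormOn A S ≤ ENNReal.ofReal r)
    (hs : 0 < s) (hrs : r < s) : ∃ x ∈ S, ‖Matrix.toEuclideanCLM (𝕜 := ℝ) A x‖ < s := by
  have := h.trans_lt ((ENNReal.ofReal_lt_ofReal_iff hs).2 hrs)
  simp only [infNormOn, iInf_lt_iff] at this
  obtain ⟨x, hx, hlt⟩ := this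
  exact ⟨x, hx, (ENNReal.ofReal_lt_ofReal_iff hs).1 hlt⟩

/-- A nearly minimal compressible vector can be replaced by a sparse one. -/
lemma exists_sparse_of_comp {n : ℕ} (hn : 0 < n) {R M : Matrix (Fin n) (Fin n) ℝ}
    {K γ δ : ℝ} (hK : 1 ≤ K) (hγ : 1 / 2 < γ) (hM : ‖M‖ ≤ (n : ℝ) ^ γ) (hδ : 0 < δ)
    (hδ1 : δ < 1 / (64 * (K + 1))) (hR : ‖R‖ ≤ K * √n) {x : EuclideanSpace ℝ (Fin n)}
    (hx : x ∈ CompVec n δ (δ * (n : ℝ) ^ (1 / 2 - γ)))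
    (hAx : ‖Matrix.toEuclideanCLM (𝕜 := ℝ) (R + M) x‖ ≤ √n / 32) :
    ∃ z ∈ SparseVec n δ, 127 / 128 ≤ ‖z‖ ∧ ‖z‖ ≤ 2 ∧
      ‖Matrix.toEuclideanCLM (𝕜 := ℝ) (R + M) z‖ ≤ 3 / 64 * √n := by
  obtain ⟨hx1, z, hz, hxz⟩ := hx
  have hn1 : (1 : ℝ) ≤ n := by exact_mod_cast hn
  have hn0 : (0 : ℝ) < n := by positivity
  have hpow : (n : ℝ) ^ (1 / 2 - γ) ≤ 1 :=
    Real.rpow_le_one_of_one_le_of_nonpos hn1 (by linarith)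
  have hpow0 : 0 < (n : ℝ) ^ (1 / 2 - γ) := by positivity
  have hmul : (n : ℝ) ^ γ * (n : ℝ) ^ (1 / 2 - γ) = √n := by
    rw [← Real.rpow_add hn0, Real.sqrt_eq_rpow]
    congr 1
    ring
  rw [lt_div_iff₀ (by positivity)] at hδ1
  rw [dist_eq_norm] at hxz
  have hxz1 : ‖x - z‖ ≤ δ := hxz.trans (mul_le_of_le_one_right hδ.le hpow)
  have hδ2 : δ ≤ 1 / 128 := by nlinarith
  have t1 := norm_sub_norm_le x z
  have t2 := norm_sub_norm_le z x
  rw [norm_sub_rev z x] at t2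
  refine ⟨z, hz, by linarith, by linarith, ?_⟩
  have hs : 0 ≤ √(n : ℝ) := Real.sqrt_nonneg _
  have hA : ‖Matrix.toEuclideanCLM (𝕜 := ℝ) (R + M) (x - z)‖ ≤ (K + 1) * δ * √n := by
    calc _ ≤ ‖R + M‖ * ‖x - z‖ := norm_toEuclideanCLM_le _ _
      _ ≤ (K * √n + (n : ℝ) ^ γ) * (δ * (n : ℝ) ^ (1 / 2 - γ)) := by
          gcongr
          exact (norm_add_le R M).trans (add_le_add hR hM)
      _ = K * √n * δ * (n : ℝ) ^ (1 / 2 - γ)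
            + δ * ((n : ℝ) ^ γ * (n : ℝ) ^ (1 / 2 - γ)) := by ring
      _ ≤ K * √n * δ * 1 + δ * √n := by rw [hmul]; gcongr
      _ = _ := by ring
  have hA' : (K + 1) * δ * √n ≤ 1 / 64 * √n := by
    gcongr
    linarith
  have e : Matrix.toEuclideanCLM (𝕜 := ℝ) (R + M) z
      = Matrix.toEuclideanCLM (𝕜 := ℝ) (R + M) x
        - Matrix.toEuclideanCLM (𝕜 := ℝ) (R + M) (x - z) := by
    rw [map_sub]; abel
  rw [e]
  refine (norm_sub_le _ _).trans ?_
  linarith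

/-- Deterministic reduction from compressible vectors to nets of sparse vectors. -/
lemma exists_net_point_of_comp {n : ℕ} (hn : 0 < n) {R M : Matrix (Fin n) (Fin n) ℝ}
    {K γ δ : ℝ} (hK : 1 ≤ K) (hγ : 1 / 2 < γ) (hM : ‖M‖ ≤ (n : ℝ) ^ γ) (hδ : 0 < δ)
    (hδ1 : δ < 1 / (64 * (K + 1))) (hR : ‖R‖ ≤ K * √n)
    (hinf : infNormOn (R + M) (CompVec n δ (δ * (n : ℝ) ^ (1 / 2 - γ)))
      ≤ ENNReal.ofReal (1 / 64 * √n))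
    {T : Finset (Fin n) → Finset (EuclideanSpace ℝ (Fin n))}
    (hT : ∀ J, ∀ z : EuclideanSpace ℝ (Fin n), (∀ i ∉ J, z i = 0) → ‖z‖ ≤ 2 →
      ‖Matrix.toEuclideanCLM (𝕜 := ℝ) M z‖ ≤ 2 * (K + 1) * √n →
      ∃ y ∈ T J, ‖z - y‖ ≤ 2 * (1 / (64 * (K + 1))) ∧
        ‖Matrix.toEuclideanCLM (𝕜 := ℝ) M z - Matrix.toEuclideanCLM (𝕜 := ℝ) M y‖
          ≤ 2 * (K + 1) * √n * (1 / (64 * (K + 1)))) :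
    ∃ J : Finset (Fin n), (J.card : ℝ) ≤ δ * n ∧ ∃ y ∈ T J, y ≠ 0 ∧
      ‖Matrix.toEuclideanCLM (𝕜 := ℝ) (R + M) y‖ ≤ ‖y‖ * √n / 2 := by
  classical
  have hs : 0 < √(n : ℝ) := Real.sqrt_pos.2 (by exact_mod_cast hn)
  obtain ⟨x, hx, hAx⟩ := exists_norm_lt_of_infNormOn_le hinf
    (s := √n / 32) (by positivity) (by linarith)
  obtain ⟨z, hz, hz1, hz2, hAz⟩ := exists_sparse_of_comp hn hK hγ hM hδ hδ1 hR hx hAx.le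
  have hK0 : 0 < K + 1 := by linarith
  set ε : ℝ := 1 / (64 * (K + 1)) with hε
  have hεK : ε * (K + 1) = 1 / 64 := by rw [hε]; field_simp
  have hε0 : 0 < ε := by positivity
  have hadd : ∀ u, Matrix.toEuclideanCLM (𝕜 := ℝ) (R + M) u
      = Matrix.toEuclideanCLM (𝕜 := ℝ) R u + Matrix.toEuclideanCLM (𝕜 := ℝ) M u := fun u => by
    rw [map_add]; rfl
  have hRu : ∀ u, ‖Matrix.toEuclideanCLM (𝕜 := ℝ) R u‖ ≤ K * √n * ‖u‖ := fun u =>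
    (norm_toEuclideanCLM_le R u).trans (by gcongr)
  have hMz : ‖Matrix.toEuclideanCLM (𝕜 := ℝ) M z‖ ≤ 2 * (K + 1) * √n := by
    have e : Matrix.toEuclideanCLM (𝕜 := ℝ) M z = Matrix.toEuclideanCLM (𝕜 := ℝ) (R + M) z
        - Matrix.toEuclideanCLM (𝕜 := ℝ) R z := by rw [hadd]; abel
    rw [e]
    calc _ ≤ 3 / 64 * √n + K * √n * 2 :=
          (norm_sub_le _ _).trans (add_le_add hAz ((hRu z).trans (by gcongr)))
      _ ≤ _ := by nlinarith
  let J : Finset (Fin n) := Finset.univ.filter fun i => z i ≠ 0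
  obtain ⟨y, hy, hzy, hMy⟩ := hT J z (fun i hi => by simpa [J] using hi) hz2 hMz
  have t := norm_sub_norm_le z y
  have hε1 : ε ≤ 1 / 128 := by nlinarith
  have hy1 : 1 / 2 ≤ ‖y‖ := by linarith
  refine ⟨J, ?_, y, hy, norm_pos_iff.1 (by linarith), ?_⟩
  · have hz' : (({i | z i ≠ 0} : Set (Fin n)).ncard : ℝ) ≤ δ * n := hz
    rwa [show ({i | z i ≠ 0} : Set (Fin n)) = (J : Set (Fin n)) by ext; simp [J],
      Set.ncard_coe_finset] at hz'
  · have e : Matrix.toEuclideanCLM (𝕜 := ℝ) (R + M) y = Matrix.toEuclideanCLM (𝕜 := ℝ) (R + M) z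
        - Matrix.toEuclideanCLM (𝕜 := ℝ) R (z - y) - (Matrix.toEuclideanCLM (𝕜 := ℝ) M z
          - Matrix.toEuclideanCLM (𝕜 := ℝ) M y) := by
      rw [hadd, hadd, map_sub]; abel
    rw [e]
    calc _ ≤ 3 / 64 * √n + K * √n * (2 * ε) + 2 * (K + 1) * √n * ε :=
          (norm_sub_le _ _).trans (add_le_add ((norm_sub_le _ _).trans
            (add_le_add hAz ((hRu _).trans (by gcongr)))) hMy)
      _ = 3 / 64 * √n + 4 * (ε * (K + 1)) * √n - 2 * ε * √n := by ring
      _ ≤ 1 / 2 * √n / 2 := by rw [hεK]; nlinarith [mul_pos hε0 hs]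
      _ ≤ _ := by gcongr

/-- The union bound over nets of sparse vectors. -/
lemma measureReal_comp_le {Ω : Type*} [MeasurableSpace Ω] {P : Measure Ω}
    [IsProbabilityMeasure P] {n : ℕ} (hn : 0 < n) {R : Ω → Matrix (Fin n) (Fin n) ℝ}
    {M : Matrix (Fin n) (Fin n) ℝ} {K γ δ q : ℝ} (hK : 1 ≤ K) (hγ : 1 / 2 < γ)
    (hM : ‖M‖ ≤ (n : ℝ) ^ γ) (hδ : 0 < δ) (hδ1 : δ < 1 / (64 * (K + 1)))
    (hball : ∀ z : EuclideanSpace ℝ (Fin n), z ≠ 0 →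
      P.real {ω | ‖Matrix.toEuclideanCLM (𝕜 := ℝ) (R ω + M) z‖ ≤ ‖z‖ * √n / 2} ≤ q) :
    P.real {ω | infNormOn (R ω + M) (CompVec n δ (δ * (n : ℝ) ^ (1 / 2 - γ)))
        ≤ ENNReal.ofReal (1 / 64 * √n) ∧ ‖R ω‖ ≤ K * √n}
      ≤ (∑ J : Finset (Fin n) with (J.card : ℝ) ≤ δ * n,
          (1 + 2 / (1 / (64 * (K + 1)))) ^ J.card) * q := by
  classical
  have hs : 0 < √(n : ℝ) := Real.sqrt_pos.2 (by exact_mod_cast hn)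
  have hK0 : 0 < K + 1 := by linarith
  choose T hTcard hT using fun J : Finset (Fin n) => exists_net_supported J
    (Matrix.toEuclideanCLM (𝕜 := ℝ) M).toLinearMap (a := 2) (b := 2 * (K + 1) * √n)
    (ε := 1 / (64 * (K + 1))) (by norm_num) (by positivity) (by positivity)
  let E : EuclideanSpace ℝ (Fin n) → Set Ω := fun y =>
    {ω | ‖Matrix.toEuclideanCLM (𝕜 := ℝ) (R ω + M) y‖ ≤ ‖y‖ * √n / 2}
  have hsub : {ω | infNormOn (R ω + M) (CompVec n δ (δ * (n : ℝ) ^ (1 / 2 - γ)))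
        ≤ ENNReal.ofReal (1 / 64 * √n) ∧ ‖R ω‖ ≤ K * √n}
      ⊆ ⋃ J ∈ Finset.univ.filter fun J : Finset (Fin n) => (J.card : ℝ) ≤ δ * n,
        ⋃ y ∈ (T J).filter (· ≠ 0), E y := by
    rintro ω ⟨hinf, hR⟩
    obtain ⟨J, hJ, y, hy, hy0, hAy⟩ :=
      exists_net_point_of_comp hn hK hγ hM hδ hδ1 hR hinf hT
    simp only [Set.mem_iUnion, Finset.mem_filter, Finset.mem_univ, true_and]
    exact ⟨J, hJ, y, ⟨hy, hy0⟩, hAy⟩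
  have hq : 0 ≤ q := by
    have : Nonempty (Fin n) := ⟨⟨0, hn⟩⟩
    obtain ⟨z, hz⟩ := exists_ne (0 : EuclideanSpace ℝ (Fin n))
    exact measureReal_nonneg.trans (hball z hz)
  refine (measureReal_mono hsub (measure_ne_top _ _)).trans ((measureReal_biUnion_finset_le _ _).trans ?_)
  rw [Finset.sum_mul]
  refine Finset.sum_le_sum fun J _ => (measureReal_biUnion_finset_le _ _).trans ?_
  calc _ ≤ ∑ y ∈ (T J).filter (· ≠ 0), q :=
        Finset.sum_le_sum fun y hy => hball y (Finset.mem_filter.1 hy).2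
    _ = ((T J).filter (· ≠ 0)).card * q := by rw [Finset.sum_const, nsmul_eq_mul]
    _ ≤ (T J).card * q := by
        gcongr
        exact Finset.filter_subset _ _
    _ ≤ _ := by
        gcongr
        exact hTcard J


theorem lemma5p1 (K : ℝ) (hK : 1 ≤ K) (B : ℝ) (hB : 0 < B) :
    ∃ c₁ c₂ c₃ : ℝ, 0 < c₁ ∧ 0 < c₂ ∧ 0 < c₃ ∧
      ∀ (Ω Ω' : Type*) [MeasurableSpace Ω] [MeasurableSpace Ω']
        (P : Measure Ω) (P' : Measure Ω') [IsProbabilityMeasure P] [IsProbabilityMeasure P']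
        (ξ : Ω' → ℝ) (n : ℕ) (R : Ω → Matrix (Fin n) (Fin n) ℝ)
        (M : Matrix (Fin n) (Fin n) ℝ) (γ δ : ℝ),
        AEMeasurable ξ P' →
        IsSubgaussianWith ξ P' B →
        ∫ ω, ξ ω ∂P' = 0 →
        variance ξ P' = 1 →
        HasIndepCopyEntries R P ξ P' →
        1 / 2 < γ → γ < 1 →
        ‖M‖ ≤ (n : ℝ) ^ γ →
        0 < δ → δ < c₁ →
        P.real {ω | infNormOn (R ω + M) (CompVec n δ (δ * (n : ℝ) ^ (1 / 2 - γ)))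
                      ≤ ENNReal.ofReal (c₂ * (n : ℝ) ^ (1 / 2 : ℝ)) ∧
                    ‖R ω‖ ≤ K * (n : ℝ) ^ (1 / 2 : ℝ)}
          ≤ Real.exp (-c₃ * n) := by
  obtain ⟨C, hC, hmom⟩ := exists_fourth_moment_bound B hB
  have hC0 : 0 < C := by linarith
  set N : ℝ := 1 + 2 / (1 / (64 * (K + 1))) with hN
  have hK0 : 0 < K + 1 := by linarith
  have hN1 : 1 < N := by
    have : 0 < 2 / (1 / (64 * (K + 1))) := by positivity
    linarith
  set y : ℝ := 1 / (128 * C) with hy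
  have hy0 : 0 < y := by positivity
  have hy1 : y ≤ 1 := by
    rw [hy, div_le_one (by positivity)]
    linarith
  have hlog : 0 < Real.log (N / y) :=
    Real.log_pos ((one_lt_div hy0).2 (hy1.trans_lt hN1))
  refine ⟨min (1 / (64 * (K + 1))) (y / Real.log (N / y)), 1 / 64, 2 * y,
    lt_min (by positivity) (by positivity), by norm_num, by positivity, ?_⟩
  intro Ω Ω' _ _ P P' _ _ ξ n R M γ δ hξ hsub hmean hvar hR hγ _ hM hδ hδc
  rcases Nat.eq_zero_or_pos n with rfl | hn
  · simp
  obtain ⟨hind, hid⟩ := hR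
  obtain ⟨hξ4, hξC⟩ := hmom Ω' P' ξ hξ hsub
  rw [variance_of_integral_eq_zero hξ hmean] at hvar
  have hpow : ∀ i j (k : ℕ), ∫ ω, R ω i j ^ k ∂P = ∫ ω, ξ ω ^ k ∂P' := fun i j k =>
    ((hid i j).comp (measurable_id.pow_const k)).integral_eq
  have hball := fun z hz => small_ball_of_fixed_vector (z := z) hC hind
    (fun i j => (hid i j).memLp_iff.2 hξ4) (fun i j => (hid i j).integral_eq.trans hmean)
    (fun i j => (hpow i j 2).trans hvar) (fun i j => (hpow i j 4).trans_le hξC) M hz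
  rw [← Real.sqrt_eq_rpow]
  have hδ2 : δ * Real.log (N / y) ≤ y :=
    ((lt_div_iff₀ hlog).1 (hδc.trans_le (min_le_right _ _))).le
  calc _ ≤ _ := measureReal_comp_le hn hK hγ hM hδ (hδc.trans_le (min_le_left _ _)) hball
    _ ≤ Real.exp (n * (δ * Real.log (N / y) + y)) * Real.exp (-(n / (32 * C))) := by
        gcongr
        exact sum_pow_card_le_exp hN1.le hy0 hy1
    _ ≤ Real.exp (n * (y + y)) * Real.exp (-(n / (32 * C))) := by gcongr
    _ = _ := by
        rw [← Real.exp_add, hy]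
        congr 1
        field_simp
        ring
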